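/- Let $\mathcal I$ be a nonzero ideal of $\mathbb C[[x,y]]$ and let $\overline{\mathcal I}$ be its integral closure, i.e. the ideal of all $r$ satisfying $r^n+a_1r^{n-1}+\dots+a_n=0$ for some $n\ge 1$ and $a_i\in\mathcal I^i$. Then $\overline{\mathcal I}$ and $\mathcal I$ have the same Newton process. Here the Newton process is defined as follows. *Faces.* The Newton diagram $\Delta(\mathcal I)\subset\mathbb R^2$ is the convex hull of $\bigcup_{f\in\mathcal I}\operatorname{Supp} f+\mathbb R_{\ge0}^2$, where $\operatorname{Supp} f\subset\mathbb N^2$ is the set of exponents $(\alpha,\beta)$ of the monomials $x^\alpha y^\beta$ occurring in $f$. A face $S$ of $\mathcal I$ is a one-dimensional compact face of $\Delta(\mathcal I)$; its supporting line has an equation $p\alpha+q\beta=N$ with $p,q\ge1$ coprime integers and $N\in\mathbb N$. The initial ideal $\operatorname{in}(\mathcal I,S)\subset\mathbb C[x,y]$ is generated by the parts $\sum_{p\alpha+q\beta=N}c_{\alpha,\beta}x^\alpha y^\beta$ of the elements $f=\sum c_{\alpha,\beta}x^\alpha y^\beta$ of $\mathcal I$. It can be written $$\operatorname{in}(\mathcal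 I,S)=x^{a}y^{b}F(x^{q},y^{p})\,\bigl(k_1(x^{q},y^{p}),\dots,k_s(x^{q},y^{p})\bigr),$$ with $F$ homogeneous, monic in $y$ and not divisible by $x$ or $y$, and $k_1,\dots,k_s$ coprime homogeneous polynomials of the same degree $d$. Then $F$ (the face polynomial $F_{\mathcal I,S}$) and $d$ (the degree $d_S$) are uniquely determined, and $S$ is called dicritical if $d_S\ge 1$. *Newton maps.* For coprime $p,q\ge 1$ and $\mu\in\mathbb C^*$, let $(p',q')\in\mathbb N^2$ be the unique pair with $pp'-qq'=1$, $p'\le q$, $q'<p$. The Newton map $\sigma_{(p,q,\mu)}:\mathbb C[[x,y]]\to\mathbb C[[x,y]]$ is $f(x,y)\mapsto f\bigl(\mu^{q'}x^p,\;x^q(y+\mu^{p'})\bigr)$, and $\mathcal I_\sigma$ denotes the ideal generated by $\sigma(\mathcal I)$. For $\Sigma=(\sigma_1,\dots,\sigma_j)$, $j\ge 0$, put $\mathcal I_\Sigma=(\cdots(\mathcal I_{\sigma_1})\cdots)_{\sigma_j}$. *Algorithm.* An ideal has depth $0$ if it is generated by $x^k(y+h(x))^\nu$ for some $k,\nu\in\mathbb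 N$ and $h\in x\mathbb C[[x]]$. A sequence $\Sigma=(\sigma_1,\dots,\sigma_j)$ of Newton maps occurs in the Newton algorithm of $\mathcal I$ if, for every $i$, the ideal $\mathcal J=\mathcal I_{(\sigma_1,\dots,\sigma_{i-1})}$ does not have depth $0$ and $\sigma_i=\sigma_{(p,q,\mu)}$, where $p\alpha+q\beta=N$ is the supporting line of a face $S$ of $\mathcal J$ and $\mu$ is a root of $F_{\mathcal J,S}(1,X)$. *Newton process.* The Newton process of $\mathcal I$ consists of the largest $k$ such that $x^k$ divides $\mathcal I$ and of the set of the following elements, where $\Sigma$ runs through the sequences (including the empty one) occurring in the Newton algorithm of $\mathcal I$: 1. if $\mathcal I_\Sigma$ does not have depth $0$: the element $(\Sigma,\sigma_{(p,q,\mu)};d_S)$ with $\mu$ a generic symbol, for every dicritical face $S$ of $\mathcal I_\Sigma$, with supporting line $p\alpha+q\beta=N$; 2. if $\mathcal I_\Sigma=\bigl(x^k(y+h(x))^\nu\bigr)$ with $h\in x\mathbb C[[x]]$ and $\nu\ge1$: the element $(\Sigma;(y+h(x))^\nu)$; 3. if $\mathcal I_\Sigma$ does not have depth $0$ and is divisible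 by $y$: the element $(\Sigma;y^{b})$, where $y^b$ is the largest power of $y$ dividing $\mathcal I_\Sigma$. -/

import Mathlib

namespace NewtonAlg

/-! ### Integral closure of an ideal -/

section IntegralClosure

variable {R : Type*} [CommRing R]

/-- `r` is integral over the ideal `I`: it satisfies an equation
`r ^ n + a₁ r ^ (n - 1) + ⋯ + aₙ = 0` with `n ≥ 1` and `aᵢ ∈ I ^ i`. -/
def IsIntegralOver (I : Ideal R) (r : R) : Prop :=
  ∃ n : ℕ, 0 < n ∧ ∃ a : ℕ → R, (∀ i, a i ∈ I ^ i) ∧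
    r ^ n + ∑ i ∈ Finset.Icc 1 n, a i * r ^ (n - i) = 0

theorem isIntegralOver_iff_rees [Nontrivial R] (I : Ideal R) (r : R) :
    IsIntegralOver I r ↔ IsIntegral (reesAlgebra I) (Polynomial.monomial 1 r) := by
  constructor
  · rintro ⟨n, hn, a, ha, h⟩
    let c : ℕ → reesAlgebra I := fun i => ⟨Polynomial.monomial i (a i),
      reesAlgebra.monomial_mem.2 (ha i)⟩
    refine ⟨Polynomial.X ^ n + ∑ i ∈ Finset.Icc 1 n,
      Polynomial.C (c i) * Polynomial.X ^ (n - i), ?_, ?_⟩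
    · apply Polynomial.monic_X_pow_add
      refine (Polynomial.degree_sum_le _ _).trans_lt ?_
      rw [Finset.sup_lt_iff (by simp)]
      intro i hi
      rw [Finset.mem_Icc] at hi
      refine (Polynomial.degree_C_mul_X_pow_le _ _).trans_lt ?_
      exact_mod_cast (by omega : n - i < n)
    · have key : ∀ i ∈ Finset.Icc 1 n,
          (Polynomial.monomial i (a i) : Polynomial R) * Polynomial.monomial (n - i) (r ^ (n - i))
            = Polynomial.monomial n (a i * r ^ (n - i)) := by
        intro i hi
        rw [Finset.mem_Icc] at hi
        rw [Polynomial.monomial_mul_monomial]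
        congr 2
        omega
      have hc : ∀ i, algebraMap (reesAlgebra I) (Polynomial R) (c i)
          = Polynomial.monomial i (a i) := fun i => rfl
      simp only [Polynomial.eval₂_add, Polynomial.eval₂_pow, Polynomial.eval₂_X,
        Polynomial.eval₂_finsetSum, Polynomial.eval₂_mul, Polynomial.eval₂_C, hc,
        Polynomial.monomial_pow, one_mul]
      rw [Finset.sum_congr rfl key, ← map_sum, ← map_add, h, map_zero]
  · rintro ⟨P, hP, h⟩
    have hb : ∀ j : ℕ, ∀ i, ((P.coeff j : reesAlgebra I) : Polynomial R).coeff i ∈ I ^ i :=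
      fun j i => (P.coeff j).2 i
    have hdeg : 0 < P.natDegree := by
      rcases Nat.eq_zero_or_pos P.natDegree with h0 | h0
      · rw [hP.natDegree_eq_zero.1 h0] at h
        simp at h
      · exact h0
    set n := P.natDegree with hn
    refine ⟨n, hdeg, fun i => if i ≤ n then
      ((P.coeff (n - i) : reesAlgebra I) : Polynomial R).coeff i else 0, ?_, ?_⟩
    · intro i
      dsimp only
      split_ifs
      · exact hb _ _
      · exact zero_mem _
    · rw [Polynomial.eval₂_eq_sum_range] at h
      have h' := congrArg (fun Q : Polynomial R => Q.coeff n) h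
      simp only [Polynomial.finsetSum_coeff, Polynomial.coeff_zero, Polynomial.monomial_pow,
        one_mul] at h'
      rw [← hn] at h'
      have hterm : ∀ j ∈ Finset.range (n + 1),
          ((algebraMap (reesAlgebra I) (Polynomial R)) (P.coeff j) *
            Polynomial.monomial j (r ^ j)).coeff n =
          ((P.coeff j : reesAlgebra I) : Polynomial R).coeff (n - j) * r ^ j := by
        intro j hj
        rw [Finset.mem_range] at hj
        have := Polynomial.coeff_mul_monomial
          ((algebraMap (reesAlgebra I) (Polynomial R)) (P.coeff j)) j (n - j) (r ^ j)
        rw [Nat.sub_add_cancel (by omega)] at this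
        exact this
      rw [Finset.sum_congr rfl hterm, Finset.sum_range_succ] at h'
      have hlead : P.coeff n = 1 := hP
      rw [hlead] at h'
      simp only [OneMemClass.coe_one, Nat.sub_self, Polynomial.coeff_one_zero, one_mul] at h'
      refine Eq.trans ?_ h'
      rw [add_comm]
      congr 1
      refine Finset.sum_bij' (fun i _ => n - i) (fun j _ => n - j) ?_ ?_ ?_ ?_ ?_
      · intro i hi; simp only [Finset.mem_Icc, Finset.mem_range] at *; omega
      · intro i hi; simp only [Finset.mem_Icc, Finset.mem_range] at *; omega
      · intro i hi; simp only [Finset.mem_Icc] at *; omega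
      · intro i hi; simp only [Finset.mem_range] at *; omega
      · intro i hi
        simp only [Finset.mem_Icc] at hi
        simp only [if_pos hi.2, Nat.sub_sub_self hi.2]

/-- The integral closure of an ideal: the ideal of all elements integral over it. -/
def integralClosure [Nontrivial R] (I : Ideal R) : Ideal R where
  carrier := {r | IsIntegralOver I r}
  zero_mem' := by
    rw [Set.mem_ofPred_eq, isIntegralOver_iff_rees, map_zero]
    exact isIntegral_zero
  add_mem' := by
    intro a b ha hb
    rw [Set.mem_ofPred_eq, isIntegralOver_iff_rees] at *
    rw [map_add]
    exact ha.add hb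
  smul_mem' := by
    intro c a ha
    rw [Set.mem_ofPred_eq, isIntegralOver_iff_rees] at *
    have h : (Polynomial.monomial 1 (c • a) : Polynomial R) =
        algebraMap (reesAlgebra I) (Polynomial R) (algebraMap R (reesAlgebra I) c) *
          Polynomial.monomial 1 a := by
      rw [← IsScalarTower.algebraMap_apply, Polynomial.algebraMap_eq, Polynomial.C_mul_monomial,
        smul_eq_mul]
    rw [h]
    exact isIntegral_algebraMap.mul ha

end IntegralClosure

/-! ### Newton diagrams and faces -/

/-- The ring `ℂ[[x, y]]`; `x` is the variable of index `0` and `y` the variable of index `1`. -/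
abbrev Series : Type := MvPowerSeries (Fin 2) ℂ

/-- The polynomial ring `ℂ[x, y]`. -/
abbrev Poly : Type := MvPolynomial (Fin 2) ℂ

/-- The exponent of the monomial `x ^ a * y ^ b`. -/
noncomputable def expo (a b : ℕ) : Fin 2 →₀ ℕ := Finsupp.single 0 a + Finsupp.single 1 b

/-- `Supp f`. -/
def supp (f : Series) : Set (ℕ × ℕ) := {v | MvPowerSeries.coeff (expo v.1 v.2) f ≠ 0}

/-- `Δ(E)`: the smallest convex set containing `E + ℝ₊²`. -/
def diagram (E : Set (ℕ × ℕ)) : Set (ℝ × ℝ) :=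
  convexHull ℝ {z | ∃ v ∈ E, ∃ b : ℝ × ℝ, 0 ≤ b.1 ∧ 0 ≤ b.2 ∧ z = ((v.1 : ℝ), (v.2 : ℝ)) + b}

/-- The Newton diagram `Δ(I)` of an ideal. It is generated by the supports of all elements of `I`;
those of any system of generators give the same set. -/
def idealDiagram (I : Ideal Series) : Set (ℝ × ℝ) := diagram (⋃ f ∈ I, supp f)

/-- The line `p α + q β = N` (with `p, q ≥ 1` coprime) supports a face of the Newton polygon
of `I`, that is, a one-dimensional compact face of `Δ(I)`. Since `p, q > 0`, the intersection of
`Δ(I)` with a supporting line of this form is always compact. -/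
def IsFace (I : Ideal Series) (p q N : ℕ) : Prop :=
  0 < p ∧ 0 < q ∧ Nat.Coprime p q ∧
    (∀ z ∈ idealDiagram I, (N : ℝ) ≤ p * z.1 + q * z.2) ∧
    {z ∈ idealDiagram I | (p : ℝ) * z.1 + q * z.2 = N}.Nontrivial

/-! ### Initial ideals, face polynomials and dicritical degrees -/

/-- The initial part of `f` with respect to the line `p α + q β = N`, for `p, q ≥ 1`
(then every point of `ℕ × ℕ` on the line has both coordinates at most `N`). -/
noncomputable def initialPart (p q N : ℕ) (f : Series) : Poly :=
  ∑ v ∈ (Finset.range (N + 1) ×ˢ Finset.range (N + 1)).filter (fun v => p * v.1 + q * v.2 = N),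
    MvPolynomial.monomial (expo v.1 v.2) (MvPowerSeries.coeff (expo v.1 v.2) f)

/-- The initial ideal of `I` with respect to the face supported by `p α + q β = N`.
It is generated by the initial parts of all elements of `I`; on a supporting line these are
`ℂ`-linear combinations of the initial parts of any system of generators. -/
noncomputable def initialIdeal (I : Ideal Series) (p q N : ℕ) : Ideal Poly :=
  Ideal.span {g | ∃ f ∈ I, g = initialPart p q N f}

/-- `F(x ^ q, y ^ p)`. -/
noncomputable def weightSubst (p q : ℕ) (F : Poly) : Poly :=
  MvPolynomial.aeval ![(MvPolynomial.X 0 : Poly) ^ q, (MvPolynomial.X 1 : Poly) ^ p] F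

/-- The initial ideal of `I` with respect to the line `p α + q β = N` is
`x ^ a * y ^ b * F(x ^ q, y ^ p) * (k₁(x ^ q, y ^ p), …, kₛ(x ^ q, y ^ p))`, where `F` is
homogeneous, monic in `y` and not divisible by `x` or `y`, and `k₁, …, kₛ` are coprime
homogeneous polynomials of the same degree `d`. So `F` is the face polynomial and `d` the degree
`d_S` of the face. Coprimality forces `d = 0` exactly when the initial ideal is principal. -/
def HasFaceData (I : Ideal Series) (p q N : ℕ) (F : Poly) (d : ℕ) : Prop :=
  (∃ n, F.IsHomogeneous n ∧ MvPolynomial.coeff (expo 0 n) F = 1) ∧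
  ¬ (MvPolynomial.X 0 ∣ F) ∧ ¬ (MvPolynomial.X 1 ∣ F) ∧
  ∃ (a b s : ℕ) (k : Fin s → Poly),
    (∀ i, (k i).IsHomogeneous d) ∧
    (∀ g : Poly, (∀ i, g ∣ k i) → IsUnit g) ∧
    initialIdeal I p q N =
      Ideal.span {MvPolynomial.X 0 ^ a * MvPolynomial.X 1 ^ b * weightSubst p q F} *
        Ideal.span (Set.range fun i => weightSubst p q (k i))

/-! ### Newton maps -/

/-- The data `(p, q, μ)` of a Newton map, together with the canonical `(p', q')` such that
`p p' - q q' = 1`, `p' ≤ q`, `q' < p`; these are determined by `(p, q)`, and the equation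
makes `p` and `q` coprime. -/
structure NewtonMap where
  p : ℕ
  q : ℕ
  p' : ℕ
  q' : ℕ
  μ : ℂ
  p_pos : 0 < p
  q_pos : 0 < q
  bezout : p * p' = q * q' + 1
  p'_le : p' ≤ q
  q'_lt : q' < p
  μ_ne_zero : μ ≠ 0

namespace NewtonMap

/-- The images `μ ^ q' * x ^ p` of `x` and `x ^ q * (y + μ ^ p')` of `y`. -/
noncomputable def images (σ : NewtonMap) : Fin 2 → Series :=
  ![MvPowerSeries.C (σ.μ ^ σ.q') * MvPowerSeries.X 0 ^ σ.p,
    MvPowerSeries.X 0 ^ σ.q * (MvPowerSeries.X 1 + MvPowerSeries.C (σ.μ ^ σ.p'))]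

theorem hasSubst_images (σ : NewtonMap) : MvPowerSeries.HasSubst σ.images := by
  apply MvPowerSeries.hasSubst_of_constantCoeff_zero
  intro i
  fin_cases i
  · simp [images, σ.p_pos.ne']
  · simp [images, σ.q_pos.ne']

/-- The Newton map `f(x, y) ↦ f(μ ^ q' * x ^ p, x ^ q * (y + μ ^ p'))`. -/
noncomputable def hom (σ : NewtonMap) : Series →ₐ[ℂ] Series :=
  MvPowerSeries.substAlgHom σ.hasSubst_images

/-- The ideal `I_σ` generated by the image of `I`. -/
noncomputable def mapIdeal (σ : NewtonMap) (I : Ideal Series) : Ideal Series := I.map σ.hom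

end NewtonMap

/-- The ideal `I_Σ`, for a sequence `Σ` of Newton maps. -/
noncomputable def transform (I : Ideal Series) (L : List NewtonMap) : Ideal Series :=
  L.foldl (fun J σ => σ.mapIdeal J) I

/-! ### The Newton process -/

/-- `y + h(x)`. -/
noncomputable def branchSeries (h : PowerSeries ℂ) : Series :=
  MvPowerSeries.X 1 + PowerSeries.subst (MvPowerSeries.X 0 : Series) h

/-- `I` is generated by `x ^ k * (y + h(x)) ^ ν`, with `h ∈ x ℂ[[x]]`. -/
def IsGeneratedBy (I : Ideal Series) (k : ℕ) (h : PowerSeries ℂ) (ν : ℕ) : Prop :=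
  PowerSeries.constantCoeff h = 0 ∧
    I = Ideal.span {MvPowerSeries.X 0 ^ k * branchSeries h ^ ν}

/-- `I` has depth `0`. -/
def DepthZero (I : Ideal Series) : Prop := ∃ k h ν, IsGeneratedBy I k h ν

/-- `σ = σ_(p, q, μ)`, where `p α + q β = N` supports a face of the Newton polygon of `I` and
`μ` is a root of the face polynomial. -/
def IsRootMap (I : Ideal Series) (σ : NewtonMap) : Prop :=
  ∃ N F d, IsFace I σ.p σ.q N ∧ HasFaceData I σ.p σ.q N F d ∧
    MvPolynomial.eval ![1, σ.μ] F = 0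

/-- The sequence of Newton maps occurs in the Newton algorithm of `I`: each map belongs to a root
of a face polynomial of the ideal reached so far, and the algorithm stops at ideals of depth `0`. -/
def InAlgorithm : Ideal Series → List NewtonMap → Prop
  | _, [] => True
  | I, σ :: L => ¬ DepthZero I ∧ IsRootMap I σ ∧ InAlgorithm (σ.mapIdeal I) L

/-- The elements of a Newton process. -/
inductive ProcessElement where
  /-- `(σ₁, …, σⱼ, σ_(p, q, μ); d)` with `μ` generic; the generic `μ` is not recorded. -/
  | dicritical (L : List NewtonMap) (p q d : ℕ)
  /-- `(σ₁, …, σⱼ; (y + h(x)) ^ ν)`. -/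
  | branch (L : List NewtonMap) (h : PowerSeries ℂ) (ν : ℕ)

/-- The largest `k` such that `x ^ k` divides `I` (for `I ≠ 0`). -/
noncomputable def xOrder (I : Ideal Series) : ℕ :=
  sSup {k | I ≤ Ideal.span {(MvPowerSeries.X 0 : Series) ^ k}}

/-- The largest `b` such that `y ^ b` divides `I` (for `I ≠ 0`). -/
noncomputable def yOrder (I : Ideal Series) : ℕ :=
  sSup {b | I ≤ Ideal.span {(MvPowerSeries.X 1 : Series) ^ b}}

/-- Membership in the Newton process.

* A dicritical face of some ideal `I_Σ` of positive depth in the algorithm contributes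
  `(Σ, σ_(p, q, μ); d)`.
* An ideal `I_Σ = (x ^ k * (y + h) ^ ν)` of depth `0` in the algorithm, with `ν ≥ 1`,
  contributes `(Σ; (y + h) ^ ν)`.
* An ideal `I_Σ` of positive depth in the algorithm which is divisible by `y ^ b`, with `b ≥ 1`
  maximal, contributes `(Σ; y ^ b)`. -/
def InProcess (I : Ideal Series) : ProcessElement → Prop
  | .dicritical L p q d =>
      InAlgorithm I L ∧ ¬ DepthZero (transform I L) ∧ 0 < d ∧
        ∃ N F, IsFace (transform I L) p q N ∧ HasFaceData (transform I L) p q N F d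
  | .branch L h ν =>
      InAlgorithm I L ∧ 0 < ν ∧
        ((∃ k, IsGeneratedBy (transform I L) k h ν) ∨
          (¬ DepthZero (transform I L) ∧ h = 0 ∧ ν = yOrder (transform I L)))

/-- The Newton process of a nonzero ideal: the exponent of the largest power of `x` dividing it,
and the set of pairs `(Σ; Z)`. A factor `x ^ k` of the ideal has no influence on the latter. -/
noncomputable def newtonProcess (I : Ideal Series) : ℕ × Set ProcessElement :=
  (xOrder I, {e | InProcess I e})

end NewtonAlg

namespace NewtonAlg

/-! ### Integrality over ideals -/

section Integrality

variable {R S : Type*} [CommRing R] [CommRing S]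

/-! The natural setting is a pair `I ≤ J` with `J` integral over `I`, a reduction; the integral
closure is one such `J`. Integral equations survive ring homomorphisms, so reductions are preserved
by Newton maps and, by induction, along every sequence `L`. It is therefore enough that the data
read off at one stage (depth zero, orders in `x` and `y`, faces, face polynomials and degrees) agree
for `I` and `J`.

Two facts give this agreement. A principal ideal generated by a product of primes is integrally
closed, so it contains `J` as soon as it contains `I` (`IsReduction.le_span_singleton_iff`):
divisibility is detected on the reduction. And a nonzero principal ideal in a domain has no proper
reduction (`IsReduction.eq_of_span_singleton`).

For the faces, expand `f(t ^ p x, t ^ q y)` in powers of `t`. Since `t` is prime, `I` and `J` have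
the same lower bounds on weights, and the lowest-weight part of an integral equation shows that the
initial ideals again form a reduction (`IsReduction.isReduction_initialIdeal`). In the factorial
ring `ℂ[x, y]` they then have the same common divisors, and these decide whether the line carries a
face and which `F` and `d` occur. -/

theorem IsIntegralOver.mono {I J : Ideal R} (h : I ≤ J) {r : R} (hr : IsIntegralOver I r) :
    IsIntegralOver J r := by
  obtain ⟨n, hn, a, ha, e⟩ := hr
  exact ⟨n, hn, a, fun i => Ideal.pow_right_mono h i (ha i), e⟩

theorem IsIntegralOver.map {I : Ideal R} {r : R} (hr : IsIntegralOver I r) (f : R →+* S) :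
    IsIntegralOver (I.map f) (f r) := by
  obtain ⟨n, hn, a, ha, e⟩ := hr
  refine ⟨n, hn, fun i => f (a i), fun i => ?_, ?_⟩
  · rw [← Ideal.map_pow]
    exact Ideal.mem_map_of_mem f (ha i)
  · simpa using congrArg f e

/-- The coefficients of an equation of integral dependence over the ideal generated by `g` are
multiples of the powers of `g`. -/
theorem IsIntegralOver.exists_span_singleton {g r : R} (hr : IsIntegralOver (Ideal.span {g}) r) :
    ∃ n : ℕ, 0 < n ∧ ∃ c : ℕ → R,
      r ^ n + ∑ i ∈ Finset.Icc 1 n, g ^ i * c i * r ^ (n - i) = 0 := by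
  obtain ⟨n, hn, a, ha, e⟩ := hr
  have h : ∀ i, ∃ c, a i = g ^ i * c := fun i => by
    have := ha i
    rwa [Ideal.span_singleton_pow, Ideal.mem_span_singleton] at this
  choose c hc using h
  refine ⟨n, hn, c, ?_⟩
  simpa only [hc] using e

/-- Every term of the equation except `r ^ n` contains a positive power of `p`, so `p` divides `r`.
After the substitution `r = p * r'` each term contains `p ^ n`, which cancels. -/
theorem IsIntegralOver.of_span_prime_mul [IsDomain R] {p f r : R} (hp : Prime p)
    (hr : IsIntegralOver (Ideal.span {p * f}) r) :
    ∃ r', r = p * r' ∧ IsIntegralOver (Ideal.span {f}) r' := by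
  obtain ⟨n, hn, c, e⟩ := hr.exists_span_singleton
  have hdvd : p ∣ r := by
    refine hp.dvd_of_dvd_pow (n := n) ?_
    rw [eq_neg_of_add_eq_zero_left e, dvd_neg]
    refine Finset.dvd_sum fun i hi => ?_
    have hi : i ≠ 0 := by have := (Finset.mem_Icc.1 hi).1; omega
    exact Dvd.dvd.mul_right (Dvd.dvd.mul_right (dvd_pow (dvd_mul_right p f) hi) _) _
  obtain ⟨r', rfl⟩ := hdvd
  refine ⟨r', rfl, n, hn, fun i => f ^ i * c i, fun i => ?_, ?_⟩
  · rw [Ideal.span_singleton_pow, Ideal.mem_span_singleton]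
    exact dvd_mul_right _ _
  · refine (mul_eq_zero.1 (?_ : p ^ n * _ = 0)).resolve_left (pow_ne_zero n hp.ne_zero)
    rw [← e, mul_add, Finset.mul_sum, mul_pow]
    congr 1
    refine Finset.sum_congr rfl fun i hi => ?_
    have hi := (Finset.mem_Icc.1 hi).2
    calc p ^ n * (f ^ i * c i * r' ^ (n - i))
        = p ^ (i + (n - i)) * (f ^ i * c i * r' ^ (n - i)) := by rw [Nat.add_sub_cancel' hi]
      _ = (p * f) ^ i * c i * (p * r') ^ (n - i) := by ring

/-- The principal ideal generated by `g` is integrally closed. -/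
def IntegrallyClosedSpan (g : R) : Prop :=
  ∀ r, IsIntegralOver (Ideal.span {g}) r → g ∣ r

theorem IntegrallyClosedSpan.of_isUnit {g : R} (hg : IsUnit g) : IntegrallyClosedSpan g :=
  fun _ _ => hg.dvd

theorem IntegrallyClosedSpan.prime_mul [IsDomain R] {p f : R} (hp : Prime p)
    (hf : IntegrallyClosedSpan f) : IntegrallyClosedSpan (p * f) := by
  intro r hr
  obtain ⟨r', rfl, hr'⟩ := hr.of_span_prime_mul hp
  exact mul_dvd_mul_left p (hf r' hr')

theorem IntegrallyClosedSpan.prime_pow_mul [IsDomain R] {p f : R} (hp : Prime p)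
    (hf : IntegrallyClosedSpan f) (k : ℕ) : IntegrallyClosedSpan (p ^ k * f) := by
  induction k with
  | zero => simpa using hf
  | succ k ih =>
    rw [pow_succ', mul_assoc]
    exact ih.prime_mul hp

theorem IntegrallyClosedSpan.prime_pow [IsDomain R] {p : R} (hp : Prime p) (k : ℕ) :
    IntegrallyClosedSpan (p ^ k) := by
  simpa using (IntegrallyClosedSpan.of_isUnit isUnit_one).prime_pow_mul hp k

/-- Prime factors are stripped off one at a time. For `g = 0` the equation reduces to `r ^ n = 0`;
this case is used later for empty contact sets. -/
theorem integrallyClosedSpan_of_uniqueFactorizationMonoid [IsDomain R]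
    [UniqueFactorizationMonoid R] (g : R) : IntegrallyClosedSpan g := by
  induction g using UniqueFactorizationMonoid.induction_on_prime with
  | h₁ =>
    intro r hr
    obtain ⟨n, hn, c, e⟩ := hr.exists_span_singleton
    have : ∑ i ∈ Finset.Icc 1 n, (0 : R) ^ i * c i * r ^ (n - i) = 0 := by
      refine Finset.sum_eq_zero fun i hi => ?_
      have hi : i ≠ 0 := by have := (Finset.mem_Icc.1 hi).1; omega
      simp [hi]
    rw [this, add_zero] at e
    rw [eq_zero_of_pow_eq_zero e]
  | h₂ g hg => exact .of_isUnit hg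
  | h₃ g p _ hp ih => exact ih.prime_mul hp

/-- `I` is a reduction of `J`: it is contained in `J`, and `J` is integral over it. -/
structure IsReduction (I J : Ideal R) : Prop where
  le : I ≤ J
  isIntegralOver : ∀ r ∈ J, IsIntegralOver I r

theorem isReduction_integralClosure [Nontrivial R] (I : Ideal R) :
    IsReduction I (integralClosure I) where
  -- The equation is `r + a₁ = 0` with `a₁ = -r`; powers of `-r` fill the unused indices, where
  -- membership in `I ^ i` is still required.
  le r hr := ⟨1, one_pos, fun i => (-r) ^ i, fun i => Ideal.pow_mem_pow (I.neg_mem hr) i, by simp⟩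
  isIntegralOver _ hr := hr

/-- Integral elements form an ideal, so integrality need only be tested on generators. -/
theorem isReduction_span [Nontrivial R] {I : Ideal R} {s : Set R} (hI : I ≤ Ideal.span s)
    (hs : ∀ r ∈ s, IsIntegralOver I r) : IsReduction I (Ideal.span s) where
  le := hI
  isIntegralOver _ hr := (Ideal.span_le.2 hs : Ideal.span s ≤ integralClosure I) hr

theorem IsReduction.map [Nontrivial S] {I J : Ideal R} (h : IsReduction I J) (f : R →+* S) :
    IsReduction (I.map f) (J.map f) := by
  refine isReduction_span (Ideal.map_mono h.le) ?_
  rintro _ ⟨r, hr, rfl⟩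
  exact (h.isIntegralOver r hr).map f

theorem IsReduction.le_span_singleton_iff {I J : Ideal R} (h : IsReduction I J) {g : R}
    (hg : IntegrallyClosedSpan g) : J ≤ Ideal.span {g} ↔ I ≤ Ideal.span {g} :=
  ⟨h.le.trans, fun hI r hr => Ideal.mem_span_singleton.2 (hg r ((h.isIntegralOver r hr).mono hI))⟩

/-- A principal ideal has no proper reduction. -/
theorem IsReduction.eq_of_span_singleton [IsDomain R] {I : Ideal R} {g : R}
    (h : IsReduction I (Ideal.span {g})) : I = Ideal.span {g} := by
  refine le_antisymm h.le ?_
  rw [Ideal.span_singleton_le_iff_mem]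
  by_cases hg : g = 0
  · rw [hg]; exact zero_mem _
  -- `K` is the quotient ideal `(I : g)`, so `I = g K`. Dividing the integral equation of `g` by `g
  -- ^ n` writes `1` as an element of `K`, that is, `g ∈ I`.
  let K : Ideal R := Submodule.comap (LinearMap.mulLeft R g) I
  have hIK : I ≤ Ideal.span {g} * K := fun r hr => by
    obtain ⟨c, rfl⟩ := Ideal.mem_span_singleton.1 (h.le hr)
    exact Ideal.mul_mem_mul (Ideal.mem_span_singleton_self g) hr
  obtain ⟨n, hn, a, ha, e⟩ := h.isIntegralOver g (Ideal.mem_span_singleton_self g)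
  have hb : ∀ i, ∃ b ∈ K ^ i, g ^ i * b = a i := fun i => by
    have := Ideal.pow_right_mono hIK i (ha i)
    rwa [mul_pow, Ideal.span_singleton_pow, Ideal.mem_span_singleton_mul] at this
  choose b hbK hb using hb
  have hK : (1 : R) ∈ K := by
    have : 1 + ∑ i ∈ Finset.Icc 1 n, b i = 0 := by
      refine (mul_eq_zero.1 (?_ : g ^ n * _ = 0)).resolve_left (pow_ne_zero n hg)
      rw [← e, mul_add, mul_one, Finset.mul_sum]
      congr 1
      refine Finset.sum_congr rfl fun i hi => ?_
      rw [← hb, mul_right_comm, ← pow_add, Nat.add_sub_cancel' (Finset.mem_Icc.1 hi).2]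
    rw [eq_neg_of_add_eq_zero_left this]
    refine K.neg_mem (K.sum_mem fun i hi => ?_)
    exact Ideal.pow_le_self (by have := (Finset.mem_Icc.1 hi).1; omega) (hbK i)
  simpa [K] using hK

end Integrality

/-! ### Ideals of depth zero -/

instance : IsDomain Series := NoZeroDivisors.to_isDomain _

/-- Divisibility by a variable says that the order, for the weight counting that variable alone, is
at least one; over a domain such orders add under multiplication. -/
theorem prime_X (i : Fin 2) : Prime (MvPowerSeries.X i : Series) := by
  have key : ∀ f : Series, MvPowerSeries.X i ∣ f ↔
      ((1 : ℕ) : ℕ∞) ≤ f.weightedOrder (Pi.single i 1) := by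
    intro f
    rw [MvPowerSeries.X_dvd_iff]
    have hw : ∀ d : Fin 2 →₀ ℕ, Finsupp.weight (Pi.single i 1 : Fin 2 → ℕ) d = d i := by
      intro d
      rw [Finsupp.weight_apply, Finsupp.sum_fintype _ _ (by simp)]
      simp [Pi.single_apply]
    constructor
    · intro h
      refine MvPowerSeries.nat_le_weightedOrder _ fun d hd => h d ?_
      rw [hw] at hd; omega
    · intro h d hd
      refine MvPowerSeries.coeff_eq_zero_of_lt_weightedOrder (Pi.single i 1) (lt_of_lt_of_le ?_ h)
      rw [hw, hd]; norm_num
  refine ⟨fun h => ?_, fun h => ?_, fun f g h => ?_⟩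
  · simpa using congrArg (MvPowerSeries.coeff (Finsupp.single i 1)) h
  · simpa using h.map (MvPowerSeries.constantCoeff (σ := Fin 2) (R := ℂ))
  · rw [key] at h ⊢
    rw [key]
    rw [MvPowerSeries.weightedOrder_mul] at h
    by_contra! hc
    simp only [Nat.cast_one, Order.lt_one_iff] at hc
    rw [hc.1, hc.2] at h
    simp at h

/-- The images of `x` and `y` under `f(x, y) ↦ f(x, y + h(x))`. -/
noncomputable def shearImages (h : PowerSeries ℂ) : Fin 2 → Series :=
  ![MvPowerSeries.X 0, branchSeries h]

theorem hasSubst_shearImages {h : PowerSeries ℂ} (hh : PowerSeries.constantCoeff h = 0) :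
    MvPowerSeries.HasSubst (shearImages h) := by
  apply MvPowerSeries.hasSubst_of_constantCoeff_zero
  intro i
  fin_cases i
  · simp [shearImages]
  · have : MvPowerSeries.constantCoeff (PowerSeries.subst (MvPowerSeries.X 0 : Series) h) = 0 :=
      PowerSeries.constantCoeff_subst_eq_zero (by simp) h hh
    simp [shearImages, branchSeries, this]

theorem subst_shearImages_subst {h : PowerSeries ℂ} (hh : PowerSeries.constantCoeff h = 0)
    (f : Series) :
    MvPowerSeries.subst (shearImages h) (MvPowerSeries.subst (shearImages (-h)) f) = f := by
  have h1 := hasSubst_shearImages hh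
  have h2 : MvPowerSeries.HasSubst (shearImages (-h)) := hasSubst_shearImages (by simp [hh])
  rw [MvPowerSeries.subst_comp_subst_apply h2 h1]
  have : (fun s => MvPowerSeries.subst (shearImages h) (shearImages (-h) s)) =
      (MvPowerSeries.X : Fin 2 → Series) := by
    have hx : PowerSeries.HasSubst (MvPowerSeries.X 0 : Series) := PowerSeries.HasSubst.X 0
    funext s
    fin_cases s
    · simpa [shearImages] using MvPowerSeries.subst_X (R := ℂ) h1 0
    -- The shear fixes `x`, hence every series in `x` alone, so the two shifts of `y` cancel.
    · have e : MvPowerSeries.subst (shearImages h)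
          (PowerSeries.subst (MvPowerSeries.X 0 : Series) (-h)) =
          PowerSeries.subst (MvPowerSeries.X 0 : Series) (-h) := by
        rw [PowerSeries.subst_def, MvPowerSeries.subst_comp_subst_apply hx.const h1,
          MvPowerSeries.subst_X h1]
        rfl
      have e2 : PowerSeries.subst (MvPowerSeries.X 0 : Series) (-h) =
          - PowerSeries.subst (MvPowerSeries.X 0 : Series) h := by
        rw [← PowerSeries.coe_substAlgHom hx, map_neg]
      change MvPowerSeries.subst (shearImages h) (branchSeries (-h)) = _
      rw [branchSeries, MvPowerSeries.subst_add h1, e, MvPowerSeries.subst_X h1, e2]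
      simp [shearImages, branchSeries]
  rw [this, MvPowerSeries.subst_self]
  rfl

/-- The automorphism `f(x, y) ↦ f(x, y + h(x))`. -/
noncomputable def shear {h : PowerSeries ℂ} (hh : PowerSeries.constantCoeff h = 0) :
    Series ≃* Series where
  toFun := MvPowerSeries.subst (shearImages h)
  invFun := MvPowerSeries.subst (shearImages (-h))
  left_inv f := by
    have := subst_shearImages_subst (h := -h) (by simp [hh]) f
    rwa [neg_neg] at this
  right_inv f := subst_shearImages_subst hh f
  map_mul' := MvPowerSeries.subst_mul (hasSubst_shearImages hh)

theorem prime_branchSeries {h : PowerSeries ℂ} (hh : PowerSeries.constantCoeff h = 0) :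
    Prime (branchSeries h) := by
  have : shear hh (MvPowerSeries.X 1) = branchSeries h :=
    MvPowerSeries.subst_X (hasSubst_shearImages hh) 1
  rw [← this, MulEquiv.prime_iff]
  exact prime_X 1

/-- If `J` is principal, it equals its reduction `I`. If `I` is generated by the given product of
primes, it is integrally closed and absorbs `J`. -/
theorem IsReduction.isGeneratedBy_iff {I J : Ideal Series} (hIJ : IsReduction I J) (k : ℕ)
    (h : PowerSeries ℂ) (ν : ℕ) : IsGeneratedBy J k h ν ↔ IsGeneratedBy I k h ν := by
  constructor
  · rintro ⟨hh, rfl⟩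
    exact ⟨hh, hIJ.eq_of_span_singleton⟩
  · rintro ⟨hh, rfl⟩
    refine ⟨hh, le_antisymm ?_ hIJ.le⟩
    exact (hIJ.le_span_singleton_iff
      ((IntegrallyClosedSpan.prime_pow (prime_branchSeries hh) ν).prime_pow_mul (prime_X 0) k)).2
        le_rfl

theorem IsReduction.depthZero_iff {I J : Ideal Series} (hIJ : IsReduction I J) :
    DepthZero J ↔ DepthZero I := by
  simp only [DepthZero, hIJ.isGeneratedBy_iff]

theorem IsReduction.xOrder_eq {I J : Ideal Series} (hIJ : IsReduction I J) :
    xOrder J = xOrder I := by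
  simp only [xOrder, hIJ.le_span_singleton_iff (.prime_pow (prime_X 0) _)]

theorem IsReduction.yOrder_eq {I J : Ideal Series} (hIJ : IsReduction I J) :
    yOrder J = yOrder I := by
  simp only [yOrder, hIJ.le_span_singleton_iff (.prime_pow (prime_X 1) _)]

/-! ### The expansion of a series into weighted homogeneous parts -/

theorem expo_self (d : Fin 2 →₀ ℕ) : expo (d 0) (d 1) = d := by
  ext i
  fin_cases i <;> simp [expo]

@[simp] theorem expo_zero (a b : ℕ) : expo a b 0 = a := by simp [expo]

@[simp] theorem expo_one (a b : ℕ) : expo a b 1 = b := by simp [expo]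

theorem coeff_initialPart {p q : ℕ} (hp : 0 < p) (hq : 0 < q) (N : ℕ) (f : Series)
    (d : Fin 2 →₀ ℕ) : MvPolynomial.coeff d (initialPart p q N f) =
      if p * d 0 + q * d 1 = N then MvPowerSeries.coeff d f else 0 := by
  classical
  simp only [initialPart, MvPolynomial.coeff_sum, MvPolynomial.coeff_monomial]
  have hd : ∀ v : ℕ × ℕ, expo v.1 v.2 = d ↔ v = (d 0, d 1) := by
    rintro ⟨a, b⟩
    constructor
    · rintro rfl
      simp
    · rintro h
      rw [h]
      exact expo_self d
  simp only [hd, Finset.sum_ite_eq', Finset.mem_filter, Finset.mem_product, Finset.mem_range,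
    expo_self]
  refine if_congr ⟨fun h => h.2, fun h => ⟨?_, h⟩⟩ rfl rfl
  constructor <;> nlinarith

/-- Weights are additive: each splitting of an exponent contributes to exactly one splitting of its
weight. This is the multiplicativity of `weightExpansion`. -/
theorem initialPart_mul {p q : ℕ} (hp : 0 < p) (hq : 0 < q) (N : ℕ) (f g : Series) :
    initialPart p q N (f * g) = ∑ m ∈ Finset.HasAntidiagonal.antidiagonal N,
      initialPart p q m.1 f * initialPart p q m.2 g := by
  classical
  ext d
  rw [coeff_initialPart hp hq, MvPowerSeries.coeff_mul, MvPolynomial.coeff_sum]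
  simp only [MvPolynomial.coeff_mul, coeff_initialPart hp hq]
  rw [Finset.sum_comm]
  have key : ∀ u ∈ Finset.HasAntidiagonal.antidiagonal d,
      ∑ m ∈ Finset.HasAntidiagonal.antidiagonal N,
        (if p * u.1 0 + q * u.1 1 = m.1 then MvPowerSeries.coeff u.1 f else 0) *
          (if p * u.2 0 + q * u.2 1 = m.2 then MvPowerSeries.coeff u.2 g else 0) =
      if p * d 0 + q * d 1 = N then MvPowerSeries.coeff u.1 f * MvPowerSeries.coeff u.2 g
        else 0 := by
    intro u hu
    rw [Finset.HasAntidiagonal.mem_antidiagonal] at hu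
    subst hu
    have hw : p * (u.1 + u.2) 0 + q * (u.1 + u.2) 1 =
        (p * u.1 0 + q * u.1 1) + (p * u.2 0 + q * u.2 1) := by
      simp only [Finsupp.add_apply]
      ring
    rw [hw]
    split_ifs with h
    · rw [Finset.sum_eq_single_of_mem (p * u.1 0 + q * u.1 1, p * u.2 0 + q * u.2 1)]
      · simp
      · simpa using h
      · rintro ⟨i, j⟩ - hij
        rw [Ne, Prod.mk.injEq, not_and_or] at hij
        rcases hij with h | h
        · rw [if_neg (Ne.symm h), zero_mul]
        · rw [if_neg (Ne.symm h), mul_zero]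
    · refine Finset.sum_eq_zero fun m hm => ?_
      rw [Finset.HasAntidiagonal.mem_antidiagonal] at hm
      by_cases h1 : p * u.1 0 + q * u.1 1 = m.1
      · have h2 : p * u.2 0 + q * u.2 1 ≠ m.2 := fun h2 => h (by rw [h1, h2, hm])
        rw [if_neg h2, mul_zero]
      · rw [if_neg h1, zero_mul]
  rw [Finset.sum_congr rfl key]
  split_ifs <;> simp

/-- The ring homomorphism `f(x, y) ↦ f(t ^ p x, t ^ q y)`: the coefficient of `t ^ N` is the part
of weight `N` of `f`. -/
noncomputable def weightExpansion {p q : ℕ} (hp : 0 < p) (hq : 0 < q) :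
    Series →+* PowerSeries Poly where
  toFun f := PowerSeries.mk fun N => initialPart p q N f
  map_one' := by
    classical
    ext N d
    rw [PowerSeries.coeff_mk, coeff_initialPart hp hq, PowerSeries.coeff_one,
      MvPowerSeries.coeff_one]
    by_cases hd : d = 0
    · subst hd
      by_cases hN : N = 0 <;> simp [hN, Ne.symm]
    · rw [if_neg hd, ite_self]
      split_ifs with hN
      · rw [MvPolynomial.coeff_one, if_neg (Ne.symm hd)]
      · simp
  map_zero' := by
    ext N d
    simp [coeff_initialPart hp hq]
  map_add' f g := by
    ext N d
    simp only [PowerSeries.coeff_mk, coeff_initialPart hp hq, map_add, MvPolynomial.coeff_add]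
    split_ifs <;> simp
  map_mul' f g := by
    ext1 N
    rw [PowerSeries.coeff_mul]
    simp only [PowerSeries.coeff_mk, initialPart_mul hp hq]

theorem coeff_weightExpansion {p q : ℕ} (hp : 0 < p) (hq : 0 < q) (N : ℕ) (f : Series) :
    PowerSeries.coeff N (weightExpansion hp hq f) = initialPart p q N f :=
  PowerSeries.coeff_mk N (fun N => initialPart p q N f)

theorem X_pow_dvd_weightExpansion_iff {p q : ℕ} (hp : 0 < p) (hq : 0 < q) (N : ℕ) (f : Series) :
    PowerSeries.X ^ N ∣ weightExpansion hp hq f ↔ ∀ v ∈ supp f, N ≤ p * v.1 + q * v.2 := by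
  rw [PowerSeries.X_pow_dvd_iff]
  simp only [coeff_weightExpansion]
  constructor
  · intro h v hv
    by_contra! hlt
    have := congrArg (MvPolynomial.coeff (expo v.1 v.2)) (h _ hlt)
    rw [coeff_initialPart hp hq] at this
    simp only [expo_zero, expo_one, if_true, MvPolynomial.coeff_zero] at this
    exact hv this
  · intro h m hm
    ext d
    rw [coeff_initialPart hp hq, MvPolynomial.coeff_zero]
    split_ifs with hd
    · by_contra hne
      have := h (d 0, d 1) (by rwa [supp, Set.mem_ofPred_eq, expo_self])
      simp only at this
      omega
    · rfl

/-- Lowest terms multiply, where `m` and `n` are only lower bounds for the orders, so the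
coefficients may vanish. -/
theorem coeff_add_mul_of_X_pow_dvd {R : Type*} [CommRing R] {m n : ℕ} {f g : PowerSeries R}
    (hf : PowerSeries.X ^ m ∣ f) (hg : PowerSeries.X ^ n ∣ g) :
    PowerSeries.coeff (m + n) (f * g) = PowerSeries.coeff m f * PowerSeries.coeff n g := by
  obtain ⟨f, rfl⟩ := hf
  obtain ⟨g, rfl⟩ := hg
  have : (PowerSeries.X ^ m * f * (PowerSeries.X ^ n * g) : PowerSeries R) =
    PowerSeries.X ^ (m + n) * (f * g) := by ring
  rw [this]
  have h := fun (k : ℕ) (e : PowerSeries R) => PowerSeries.coeff_X_pow_mul e k 0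
  simp only [zero_add] at h
  rw [h, h, h]
  simp only [PowerSeries.coeff_zero_eq_constantCoeff, map_mul]

/-- All exponents of the elements of `I` have weight at least `N`. -/
def WeightGE (I : Ideal Series) (p q N : ℕ) : Prop :=
  ∀ f ∈ I, ∀ v ∈ supp f, N ≤ p * v.1 + q * v.2

/-- A weight bound is divisibility of the expansion by `t ^ N`, and a power of the prime `t`
generates an integrally closed ideal. -/
theorem IsReduction.weightGE_iff {I J : Ideal Series} (hIJ : IsReduction I J) {p q : ℕ}
    (hp : 0 < p) (hq : 0 < q) (N : ℕ) : WeightGE J p q N ↔ WeightGE I p q N := by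
  refine ⟨fun h f hf => h f (hIJ.le hf), fun h f hf => ?_⟩
  rw [← X_pow_dvd_weightExpansion_iff hp hq]
  refine IntegrallyClosedSpan.prime_pow PowerSeries.X_prime N _
    (((hIJ.isIntegralOver f hf).map (weightExpansion hp hq)).mono ?_)
  rw [Ideal.map_le_iff_le_comap]
  intro g hg
  rw [Ideal.mem_comap, Ideal.mem_span_singleton, X_pow_dvd_weightExpansion_iff]
  exact h g hg

theorem WeightGE.pow {I : Ideal Series} {p q N : ℕ} (h : WeightGE I p q N) (hp : 0 < p)
    (hq : 0 < q) (i : ℕ) : ∀ f ∈ I ^ i, PowerSeries.X ^ (i * N) ∣ weightExpansion hp hq f ∧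
      initialPart p q (i * N) f ∈ initialIdeal I p q N ^ i := by
  simp only [← coeff_weightExpansion hp hq]
  induction i with
  | zero => simp
  | succ i ih =>
    intro f hf
    rw [pow_succ] at hf
    rw [add_mul, one_mul]
    refine Submodule.mul_induction_on hf (fun a ha b hb => ?_) (fun a b ha hb => ?_)
    · have hb' := (X_pow_dvd_weightExpansion_iff hp hq N b).2 (h b hb)
      rw [map_mul, pow_add, pow_succ, coeff_add_mul_of_X_pow_dvd (ih a ha).1 hb']
      refine ⟨mul_dvd_mul (ih a ha).1 hb', Ideal.mul_mem_mul (ih a ha).2 ?_⟩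
      exact Ideal.subset_span ⟨b, hb, coeff_weightExpansion hp hq N b⟩
    · rw [map_add, map_add]
      exact ⟨dvd_add ha.1 hb.1, Ideal.add_mem _ ha.2 hb.2⟩

/-- Take the part of weight `n * N` of an integral equation of degree `n`. Since `a i` has weight at
least `i * N` and `f ^ (n - i)` at least `(n - i) * N`, only products of lowest parts remain, and
`WeightGE.pow` puts the new coefficients in the powers of the initial ideal. -/
theorem IsReduction.isReduction_initialIdeal {I J : Ideal Series} (hIJ : IsReduction I J)
    {p q N : ℕ}
    (hp : 0 < p) (hq : 0 < q) (h : WeightGE I p q N) :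
    IsReduction (initialIdeal I p q N) (initialIdeal J p q N) := by
  refine isReduction_span (Ideal.span_mono ?_) ?_
  · rintro _ ⟨f, hf, rfl⟩
    exact ⟨f, hIJ.le hf, rfl⟩
  rintro _ ⟨f, hf, rfl⟩
  obtain ⟨n, hn, a, ha, e⟩ := hIJ.isIntegralOver f hf
  have hX := (X_pow_dvd_weightExpansion_iff hp hq N f).2 (((hIJ.weightGE_iff hp hq N).2 h) f hf)
  have hpow : ∀ m, PowerSeries.X ^ (m * N) ∣ weightExpansion hp hq f ^ m ∧
      PowerSeries.coeff (m * N) (weightExpansion hp hq f ^ m) = initialPart p q N f ^ m := by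
    intro m
    induction m with
    | zero => simp
    | succ m ih =>
      rw [add_mul, one_mul, pow_succ (weightExpansion hp hq f),
        coeff_add_mul_of_X_pow_dvd ih.1 hX, ih.2, coeff_weightExpansion, pow_succ, pow_add]
      exact ⟨mul_dvd_mul ih.1 hX, rfl⟩
  refine ⟨n, hn, fun i => initialPart p q (i * N) (a i), fun i => (h.pow hp hq i _ (ha i)).2, ?_⟩
  have e' := congrArg (fun g => PowerSeries.coeff (n * N) (weightExpansion hp hq g)) e
  simp only [map_add, map_sum, map_mul, map_pow, map_zero] at e'
  rw [(hpow n).2] at e'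
  rw [← e']
  congr 1
  refine Finset.sum_congr rfl fun i hi => ?_
  have : n * N = i * N + (n - i) * N := by
    rw [← add_mul, Nat.add_sub_cancel' (Finset.mem_Icc.1 hi).2]
  rw [this, coeff_add_mul_of_X_pow_dvd (h.pow hp hq i _ (ha i)).1 (hpow (n - i)).1, (hpow _).2,
    coeff_weightExpansion]

/-! ### Faces in terms of supports -/

/-- The exponents of elements of `I` on the line `p α + q β = N`. -/
def contactSet (I : Ideal Series) (p q N : ℕ) : Set (ℕ × ℕ) :=
  {v | (∃ f ∈ I, v ∈ supp f) ∧ p * v.1 + q * v.2 = N}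

theorem mem_idealDiagram {I : Ideal Series} {f : Series} (hf : f ∈ I) {v : ℕ × ℕ}
    (hv : v ∈ supp f) : ((v.1 : ℝ), (v.2 : ℝ)) ∈ idealDiagram I :=
  subset_convexHull ℝ _ ⟨v, Set.mem_biUnion hf hv, 0, le_rfl, le_rfl, by simp⟩

theorem idealDiagram_subset {I : Ideal Series} {C : Set (ℝ × ℝ)} (hC : Convex ℝ C)
    (h : ∀ f ∈ I, ∀ v ∈ supp f, ∀ b : ℝ × ℝ, 0 ≤ b.1 → 0 ≤ b.2 →
      ((v.1 : ℝ), (v.2 : ℝ)) + b ∈ C) : idealDiagram I ⊆ C := by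
  refine convexHull_min ?_ hC
  rintro _ ⟨v, hv, b, hb1, hb2, rfl⟩
  simp only [Set.mem_iUnion] at hv
  obtain ⟨f, hf, hv⟩ := hv
  exact h f hf v hv b hb1 hb2

/-- If a line bounds a set of points from below and meets it in at most one point, the same holds
for its convex hull. -/
theorem convex_weight_ge_and_eq (p q N : ℝ) (z₀ : ℝ × ℝ) :
    Convex ℝ {z : ℝ × ℝ | N ≤ p * z.1 + q * z.2 ∧ (p * z.1 + q * z.2 = N → z = z₀)} := by
  rintro z ⟨hz, hz'⟩ w ⟨hw, hw'⟩ a b ha hb hab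
  have e : p * (a • z + b • w).1 + q * (a • z + b • w).2 =
      a * (p * z.1 + q * z.2) + b * (p * w.1 + q * w.2) := by
    simp only [Prod.fst_add, Prod.snd_add, Prod.smul_fst, Prod.smul_snd, smul_eq_mul]
    ring
  simp only [Set.mem_ofPred_eq]
  rw [e]
  have hN : N = a * N + b * N := by rw [← add_mul, hab, one_mul]
  have h1 := mul_le_mul_of_nonneg_left hz ha
  have h2 := mul_le_mul_of_nonneg_left hw hb
  refine ⟨by linarith, fun h => ?_⟩
  -- A convex combination of values at least `N` equals `N` only if each summand with nonzero
  -- coefficient attains it.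
  have h1' : a * (p * z.1 + q * z.2 - N) = 0 := by linarith
  have h2' : b * (p * w.1 + q * w.2 - N) = 0 := by linarith
  have hza : a • z = a • z₀ := by
    rcases mul_eq_zero.1 h1' with h | h
    · simp [h]
    · rw [hz' (by linarith)]
  have hwb : b • w = b • z₀ := by
    rcases mul_eq_zero.1 h2' with h | h
    · simp [h]
    · rw [hw' (by linarith)]
  rw [hza, hwb, ← add_smul, hab, one_smul]

/-- Faces are reduced to lattice exponents: with at most one exponent on the line, the diagram stays
inside a convex set that meets the line in at most one point. -/
theorem isFace_iff_contactSet_nontrivial {I : Ideal Series} {p q N : ℕ} :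
    IsFace I p q N ↔
    0 < p ∧ 0 < q ∧ Nat.Coprime p q ∧ WeightGE I p q N ∧ (contactSet I p q N).Nontrivial := by
  unfold IsFace
  refine and_congr_right fun hp => and_congr_right fun hq => and_congr_right fun _ => ?_
  have hp' : (0 : ℝ) < p := by exact_mod_cast hp
  have hq' : (0 : ℝ) < q := by exact_mod_cast hq
  constructor
  · rintro ⟨hN, hc⟩
    have hW : WeightGE I p q N := fun f hf v hv => by
      have := hN _ (mem_idealDiagram hf hv)
      simp only at this
      exact_mod_cast this
    refine ⟨hW, ?_⟩
    by_contra hs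
    rw [Set.not_nontrivial_iff] at hs
    obtain ⟨v₀, hv₀⟩ : ∃ v₀, ∀ v ∈ contactSet I p q N, v = v₀ := by
      rcases (contactSet I p q N).eq_empty_or_nonempty with h | ⟨v₀, h⟩
      · exact ⟨0, by simp [h]⟩
      · exact ⟨v₀, fun v hv => hs hv h⟩
    have hsub : idealDiagram I ⊆ {z : ℝ × ℝ | (N : ℝ) ≤ p * z.1 + q * z.2 ∧
        (p * z.1 + q * z.2 = N → z = ((v₀.1 : ℝ), (v₀.2 : ℝ)))} := by
      refine idealDiagram_subset (convex_weight_ge_and_eq _ _ _ _) fun f hf v hv b hb1 hb2 => ?_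
      have hv' : (N : ℝ) ≤ p * v.1 + q * v.2 := by exact_mod_cast hW f hf v hv
      have h1 := mul_nonneg hp'.le hb1
      have h2 := mul_nonneg hq'.le hb2
      simp only [Set.mem_ofPred_eq, Prod.fst_add, Prod.snd_add]
      refine ⟨by linarith, fun h => ?_⟩
      have hb1' : b.1 = 0 := (mul_eq_zero.1 (by linarith : (p : ℝ) * b.1 = 0)).resolve_left hp'.ne'
      have hb2' : b.2 = 0 := (mul_eq_zero.1 (by linarith : (q : ℝ) * b.2 = 0)).resolve_left hq'.ne'
      have hb : b = 0 := Prod.ext hb1' hb2'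
      have hvN : (p : ℝ) * v.1 + q * v.2 = N := by rw [hb1', hb2'] at h; linarith
      rw [hb, add_zero, ← hv₀ v ⟨⟨f, hf, hv⟩, by exact_mod_cast hvN⟩]
    obtain ⟨z, hz, w, hw, hzw⟩ := hc
    exact hzw (((hsub hz.1).2 hz.2).trans ((hsub hw.1).2 hw.2).symm)
  · rintro ⟨hW, hc⟩
    refine ⟨fun z hz => ?_, ?_⟩
    · have hconv : Convex ℝ {z : ℝ × ℝ | (N : ℝ) ≤ p * z.1 + q * z.2} := by
        refine convex_halfSpace_ge (f := fun z : ℝ × ℝ => (p : ℝ) * z.1 + q * z.2) ⟨?_, ?_⟩ _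
        · intro z w; simp only [Prod.fst_add, Prod.snd_add]; ring
        · intro c z; simp only [Prod.smul_fst, Prod.smul_snd, smul_eq_mul]; ring
      refine idealDiagram_subset hconv (fun f hf v hv b hb1 hb2 => ?_) hz
      have hv' : (N : ℝ) ≤ p * v.1 + q * v.2 := by exact_mod_cast hW f hf v hv
      have h1 := mul_nonneg hp'.le hb1
      have h2 := mul_nonneg hq'.le hb2
      simp only [Set.mem_ofPred_eq, Prod.fst_add, Prod.snd_add]
      linarith
    · obtain ⟨v, ⟨⟨f, hf, hv⟩, hvN⟩, w, ⟨⟨g, hg, hw⟩, hwN⟩, hvw⟩ := hc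
      refine ⟨_, ⟨mem_idealDiagram hf hv, by dsimp only; exact_mod_cast hvN⟩, _,
        ⟨mem_idealDiagram hg hw, by dsimp only; exact_mod_cast hwN⟩, fun h => hvw ?_⟩
      rw [Prod.mk.injEq, Nat.cast_inj, Nat.cast_inj] at h
      exact Prod.ext h.1 h.2

theorem coeff_initialPart_ne_zero_iff {p q N : ℕ} (hp : 0 < p) (hq : 0 < q) (f : Series)
    (d : Fin 2 →₀ ℕ) : MvPolynomial.coeff d (initialPart p q N f) ≠ 0 ↔
      (d 0, d 1) ∈ supp f ∧ p * d 0 + q * d 1 = N := by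
  rw [coeff_initialPart hp hq, supp, Set.mem_ofPred_eq, expo_self]
  split_ifs with h <;> simp [h]

theorem initialPart_eq_monomial_of_contactSet_subset {I : Ideal Series} {p q N : ℕ} (hp : 0 < p)
    (hq : 0 < q) {v : ℕ × ℕ} (h : contactSet I p q N ⊆ {v}) {f : Series} (hf : f ∈ I) :
    initialPart p q N f = MvPolynomial.monomial (expo v.1 v.2)
      (MvPolynomial.coeff (expo v.1 v.2) (initialPart p q N f)) := by
  classical
  ext d
  rw [MvPolynomial.coeff_monomial]
  split_ifs with hd
  · rw [hd]
  · by_contra hne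
    obtain ⟨hs, hN⟩ := (coeff_initialPart_ne_zero_iff hp hq f d).1 hne
    have : (d 0, d 1) = v := h ⟨⟨f, hf, hs⟩, hN⟩
    exact hd (by rw [← this]; exact expo_self d)

/-- A single contact point of `I` is a monomial dividing all its initial parts, and common divisors
pass to `J`. An exponent of `J` on the same line then dominates that point, hence equals it. -/
theorem IsReduction.contactSet_subsingleton {I J : Ideal Series} (hIJ : IsReduction I J)
    {p q N : ℕ} (hp : 0 < p) (hq : 0 < q) (hW : WeightGE I p q N)
    (hs : (contactSet I p q N).Subsingleton) : (contactSet J p q N).Subsingleton := by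
  have hred := hIJ.isReduction_initialIdeal hp hq hW
  have key : ∀ g : Poly, (∀ f ∈ I, g ∣ initialPart p q N f) →
      ∀ f ∈ J, g ∣ initialPart p q N f := by
    intro g hg f hf
    rw [← Ideal.mem_span_singleton]
    refine (hred.le_span_singleton_iff
      (integrallyClosedSpan_of_uniqueFactorizationMonoid g)).2 (Ideal.span_le.2 ?_)
      (Ideal.subset_span ⟨f, hf, rfl⟩)
    rintro _ ⟨f, hf, rfl⟩
    exact Ideal.mem_span_singleton.2 (hg f hf)
  have hne : ∀ {v f}, v ∈ supp f → p * v.1 + q * v.2 = N →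
      MvPolynomial.coeff (expo v.1 v.2) (initialPart p q N f) ≠ 0 := fun hv hN =>
    (coeff_initialPart_ne_zero_iff hp hq _ _).2 (by simpa using ⟨hv, hN⟩)
  rcases (contactSet I p q N).eq_empty_or_nonempty with he | ⟨v₀, hv₀⟩
  · rintro v ⟨⟨f, hf, hv⟩, hN⟩
    refine absurd ?_ (hne hv hN)
    -- Without contact all initial parts of `I` vanish, so `0` is a common divisor.
    have : (0 : Poly) ∣ initialPart p q N f := by
      refine key 0 (fun f hf => ?_) f hf
      rw [zero_dvd_iff]
      ext d
      by_contra hd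
      obtain ⟨hs, hN⟩ := (coeff_initialPart_ne_zero_iff hp hq f d).1 hd
      have hmem : (d 0, d 1) ∈ contactSet I p q N := ⟨⟨f, hf, hs⟩, hN⟩
      rw [he] at hmem
      exact hmem
    rw [zero_dvd_iff.1 this, MvPolynomial.coeff_zero]
  · suffices ∀ v ∈ contactSet J p q N, v = v₀ from
      fun v hv w hw => (this v hv).trans (this w hw).symm
    rintro v ⟨⟨f, hf, hv⟩, hN⟩
    have hdvd : (MvPolynomial.monomial (expo v₀.1 v₀.2) 1 : Poly) ∣ initialPart p q N f := by
      refine key _ (fun f hf => ?_) f hf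
      rw [initialPart_eq_monomial_of_contactSet_subset hp hq (fun v hv => hs hv hv₀) hf]
      exact MvPolynomial.monomial_dvd_monomial.2 ⟨Or.inr le_rfl, one_dvd _⟩
    have hle : expo v₀.1 v₀.2 ≤ expo v.1 v.2 := by
      by_contra hnle
      obtain ⟨m, hm⟩ := hdvd
      refine hne hv hN ?_
      rw [hm, MvPolynomial.coeff_monomial_mul', if_neg hnle]
    have h0 := hle 0
    have h1 := hle 1
    simp only [expo_zero, expo_one] at h0 h1
    have hN₀ := hv₀.2
    have := Nat.mul_le_mul_left p h0
    have := Nat.mul_le_mul_left q h1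
    exact Prod.ext (Nat.eq_of_mul_eq_mul_left hp (by omega))
      (Nat.eq_of_mul_eq_mul_left hq (by omega))

theorem IsReduction.isFace_iff {I J : Ideal Series} (hIJ : IsReduction I J) {p q N : ℕ} :
    IsFace J p q N ↔ IsFace I p q N := by
  rw [isFace_iff_contactSet_nontrivial, isFace_iff_contactSet_nontrivial]
  refine and_congr_right fun hp => and_congr_right fun hq => and_congr_right fun _ => ?_
  rw [hIJ.weightGE_iff hp hq]
  refine and_congr_right fun hW => ⟨fun hJ => ?_, fun hI => hI.mono ?_⟩
  · by_contra hs
    rw [Set.not_nontrivial_iff] at hs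
    exact Set.not_nontrivial_iff.2 (hIJ.contactSet_subsingleton hp hq hW hs) hJ
  · rintro v ⟨⟨f, hf, hv⟩, hN⟩
    exact ⟨⟨f, hIJ.le hf, hv⟩, hN⟩

/-! ### Weighted homogeneous polynomials and the substitution `F(x ^ q, y ^ p)` -/

theorem weight_apply (p q : ℕ) (d : Fin 2 →₀ ℕ) :
    Finsupp.weight ![p, q] d = p * d 0 + q * d 1 := by
  rw [Finsupp.weight_apply, Finsupp.sum_fintype _ _ (by simp)]
  simp [mul_comm]

theorem isWeightedHomogeneous_initialPart {p q : ℕ} (hp : 0 < p) (hq : 0 < q) (N : ℕ)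
    (f : Series) : (initialPart p q N f).IsWeightedHomogeneous ![p, q] N := by
  intro d hd
  rw [weight_apply]
  exact ((coeff_initialPart_ne_zero_iff hp hq f d).1 hd).2

/-- The component of weight `k + l` of `g * m` is `g` times the component of weight `l` of `m`;
cancel `g`. -/
theorem isWeightedHomogeneous_of_mul {w : Fin 2 → ℕ} {g m : Poly} {k l : ℕ} (hg0 : g ≠ 0)
    (hg : g.IsWeightedHomogeneous w k) (hgm : (g * m).IsWeightedHomogeneous w (k + l)) :
    m.IsWeightedHomogeneous w l := by
  let := MvPolynomial.weightedGradedAlgebra ℂ w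
  have h := DirectSum.coe_decompose_mul_add_of_left_mem
    (MvPolynomial.weightedHomogeneousSubmodule ℂ w) (i := k) (j := l) (a := g) (b := m) hg
  have h' : g * m = g * MvPolynomial.weightedHomogeneousComponent w l m := by
    rw [← MvPolynomial.decompose'_apply, ← hgm.weightedHomogeneousComponent_same]
    rw [← MvPolynomial.decompose'_apply]
    exact h
  rw [mul_left_cancel₀ hg0 h']
  exact MvPolynomial.weightedHomogeneousComponent_isWeightedHomogeneous l m

theorem le_of_mem_span_of_isWeightedHomogeneous {w : Fin 2 → ℕ} {s : Set Poly} {k l : ℕ}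
    (hs : ∀ g ∈ s, MvPolynomial.IsWeightedHomogeneous w g k) {f : Poly} (hf0 : f ≠ 0)
    (hf : f.IsWeightedHomogeneous w l) (hfs : f ∈ Ideal.span s) : k ≤ l := by
  classical
  have key : ∀ d ∈ f.support, k ≤ Finsupp.weight w d := by
    clear hf hf0
    induction hfs using Submodule.span_induction with
    | mem g hg => exact fun d hd => (hs g hg (MvPolynomial.mem_support_iff.1 hd)).ge
    | zero => simp
    | add f g _ _ hf hg =>
      intro d hd
      rcases Finset.mem_union.1 (MvPolynomial.support_add hd) with h | h
      exacts [hf d h, hg d h]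
    | smul c f _ hf =>
      intro d hd
      obtain ⟨u, -, v, hv, rfl⟩ := Finset.mem_add.1 (MvPolynomial.support_mul c f hd)
      rw [map_add]
      exact (hf v hv).trans (Nat.le_add_left _ _)
  obtain ⟨d, hd⟩ := MvPolynomial.support_nonempty.2 hf0
  exact (key d hd).trans_eq (hf (MvPolynomial.mem_support_iff.1 hd))

theorem weightSubst_monomial (p q : ℕ) (d : Fin 2 →₀ ℕ) (c : ℂ) :
    weightSubst p q (MvPolynomial.monomial d c) =
      MvPolynomial.monomial (expo (q * d 0) (p * d 1)) c := by
  rw [weightSubst, MvPolynomial.aeval_monomial, Finsupp.prod_fintype _ _ (by simp),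
    Fin.prod_univ_two]
  simp only [Matrix.cons_val_zero, Matrix.cons_val_one, ← pow_mul, MvPolynomial.algebraMap_eq]
  rw [expo, ← mul_one c, ← MvPolynomial.C_mul_monomial, ← one_mul (1 : ℂ),
    ← MvPolynomial.monomial_mul, MvPolynomial.X_pow_eq_monomial, MvPolynomial.X_pow_eq_monomial]
  simp

theorem isWeightedHomogeneous_weightSubst (p q : ℕ) {F : Poly} {n : ℕ} (hF : F.IsHomogeneous n) :
    (weightSubst p q F).IsWeightedHomogeneous ![p, q] (p * q * n) := by
  rw [F.as_sum, weightSubst, map_sum]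
  refine MvPolynomial.IsWeightedHomogeneous.sum _ _ _ fun d hd => ?_
  change (weightSubst p q _).IsWeightedHomogeneous _ _
  rw [weightSubst_monomial]
  refine MvPolynomial.isWeightedHomogeneous_monomial _ _ _ ?_
  have hd := hF (MvPolynomial.mem_support_iff.1 hd)
  rw [Finsupp.weight_apply, Finsupp.sum_fintype _ _ (by simp), Fin.sum_univ_two] at hd
  simp only [Pi.one_apply, smul_eq_mul, mul_one] at hd
  rw [weight_apply, expo_zero, expo_one, ← hd]
  ring

/-- The linear map which sends `x ^ (q * i) * y ^ (p * j)` to `x ^ i * y ^ j` and the other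
monomials to zero. -/
noncomputable def weightContract (p q : ℕ) : Poly →ₗ[ℂ] Poly :=
  (MvPolynomial.basisMonomials (Fin 2) ℂ).constr ℂ fun d =>
    if q ∣ d 0 ∧ p ∣ d 1 then MvPolynomial.monomial (expo (d 0 / q) (d 1 / p)) 1 else 0

theorem weightContract_monomial (p q : ℕ) (d : Fin 2 →₀ ℕ) (c : ℂ) :
    weightContract p q (MvPolynomial.monomial d c) =
      if q ∣ d 0 ∧ p ∣ d 1 then MvPolynomial.monomial (expo (d 0 / q) (d 1 / p)) c else 0 := by
  have : (MvPolynomial.monomial d c : Poly) =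
      c • MvPolynomial.basisMonomials (Fin 2) ℂ d := by
    simp [MvPolynomial.smul_monomial]
  rw [this, map_smul, weightContract, Module.Basis.constr_basis]
  split_ifs <;> simp [MvPolynomial.smul_monomial]

/-- Multiplication by `x ^ (q * i) * y ^ (p * j)` does not affect which exponents are divisible by
`q` and `p`. So the contraction is a retraction linear over the substituted polynomials, which lets
divisibility descend. -/
theorem weightContract_weightSubst_mul {p q : ℕ} (hp : 0 < p) (hq : 0 < q) (h m : Poly) :
    weightContract p q (weightSubst p q h * m) = h * weightContract p q m := by
  induction h using MvPolynomial.induction_on' with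
  | add f g hf hg =>
    rw [weightSubst, map_add]
    change weightContract p q ((weightSubst p q f + weightSubst p q g) * m) = _
    rw [add_mul, map_add, hf, hg, add_mul]
  | monomial u a =>
    induction m using MvPolynomial.induction_on' with
    | add f g hf hg => rw [mul_add, map_add, hf, hg, map_add, mul_add]
    | monomial v b =>
      rw [weightSubst_monomial, MvPolynomial.monomial_mul, weightContract_monomial,
        weightContract_monomial]
      simp only [Finsupp.add_apply, expo_zero, expo_one, Nat.dvd_add_right (dvd_mul_right _ _),
        mul_ite, mul_zero, MvPolynomial.monomial_mul, Nat.mul_add_div hp, Nat.mul_add_div hq]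
      congr 3
      ext i
      fin_cases i <;> simp

theorem dvd_of_weightSubst_dvd {p q : ℕ} (hp : 0 < p) (hq : 0 < q) {h k : Poly}
    (hk : weightSubst p q h ∣ weightSubst p q k) : h ∣ k := by
  obtain ⟨m, hm⟩ := hk
  have h1 : weightContract p q 1 = 1 := by
    change weightContract p q (MvPolynomial.monomial 0 1) = _
    rw [weightContract_monomial]
    simp [expo]
  have := weightContract_weightSubst_mul hp hq k 1
  rw [h1, mul_one, mul_one, hm, weightContract_weightSubst_mul hp hq] at this
  exact ⟨_, this.symm⟩

theorem weightSubst_ne_zero {p q : ℕ} (hp : 0 < p) (hq : 0 < q) {k : Poly} (hk : k ≠ 0) :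
    weightSubst p q k ≠ 0 := by
  intro h
  refine hk (zero_dvd_iff.1 (dvd_of_weightSubst_dvd hp hq ?_))
  rw [h]
  exact dvd_zero _

theorem exists_weightSubst_eq {p q : ℕ} (hp : 0 < p) (hq : 0 < q) (hpq : Nat.Coprime p q)
    {m : Poly} {d : ℕ} (hm : m.IsWeightedHomogeneous ![p, q] (p * q * d)) :
    ∃ k : Poly, k.IsHomogeneous d ∧ weightSubst p q k = m := by
  have key : ∀ v ∈ m.support, ∃ i j, v = expo (q * i) (p * j) ∧ i + j = d := by
    intro v hv
    have hv := hm (MvPolynomial.mem_support_iff.1 hv)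
    rw [weight_apply] at hv
    have h0 : q ∣ v 0 := by
      -- From `p α + q β = p q d`, coprimality gives `q ∣ α` and, below, `p ∣ β`.
      refine hpq.symm.dvd_of_dvd_mul_left ((Nat.dvd_add_left (dvd_mul_right q (v 1))).1 ?_)
      exact hv ▸ ⟨p * d, by ring⟩
    have h1 : p ∣ v 1 := by
      refine hpq.dvd_of_dvd_mul_left ((Nat.dvd_add_right (dvd_mul_right p (v 0))).1 ?_)
      exact hv ▸ ⟨q * d, by ring⟩
    obtain ⟨i, hi⟩ := h0
    obtain ⟨j, hj⟩ := h1
    refine ⟨i, j, by rw [← hi, ← hj, expo_self], ?_⟩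
    rw [hi, hj] at hv
    exact Nat.eq_of_mul_eq_mul_left (Nat.mul_pos hp hq) (by linarith)
  refine ⟨∑ v ∈ m.support, MvPolynomial.monomial (expo (v 0 / q) (v 1 / p)) (m.coeff v), ?_, ?_⟩
  · refine MvPolynomial.IsHomogeneous.sum _ _ _ fun v hv => ?_
    obtain ⟨i, j, rfl, rfl⟩ := key v hv
    refine MvPolynomial.isHomogeneous_monomial _ ?_
    simp [expo, hp, hq]
  · conv_rhs => rw [m.as_sum]
    rw [weightSubst, map_sum]
    refine Finset.sum_congr rfl fun v hv => ?_
    obtain ⟨i, j, rfl, -⟩ := key v hv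
    change weightSubst p q _ = _
    rw [weightSubst_monomial]
    simp [hp, hq]

/-! ### Face data -/

/-- The homogeneous polynomials `k` of degree `d` with `g * k(x ^ q, y ^ p)` in the initial
ideal. -/
def faceCofactors (I : Ideal Series) (p q N : ℕ) (g : Poly) (d : ℕ) : Set Poly :=
  {k | k.IsHomogeneous d ∧ g * weightSubst p q k ∈ initialIdeal I p q N}

/-- Each initial part is `g` times a form of weight `p * q * d`, and such forms are exactly the `k(x
^ q, y ^ p)`. -/
theorem initialIdeal_eq_span_mul_faceCofactors {I : Ideal Series} {p q : ℕ} (hp : 0 < p)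
    (hq : 0 < q) (hpq : Nat.Coprime p q) {g : Poly} {W d : ℕ} (hg0 : g ≠ 0)
    (hg : g.IsWeightedHomogeneous ![p, q] W)
    (hI : initialIdeal I p q (W + p * q * d) ≤ Ideal.span {g}) :
    initialIdeal I p q (W + p * q * d) = Ideal.span {g} *
      Ideal.span (weightSubst p q '' faceCofactors I p q (W + p * q * d) g d) := by
  refine le_antisymm (Ideal.span_le.2 ?_) ?_
  · rintro _ ⟨f, hf, rfl⟩
    have hmem : initialPart p q (W + p * q * d) f ∈ initialIdeal I p q (W + p * q * d) :=
      Ideal.subset_span ⟨f, hf, rfl⟩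
    obtain ⟨m, hm⟩ := Ideal.mem_span_singleton.1 (hI hmem)
    have hhom := isWeightedHomogeneous_initialPart hp hq (W + p * q * d) f
    rw [hm] at hhom hmem ⊢
    obtain ⟨k, hk, rfl⟩ := exists_weightSubst_eq hp hq hpq
      (isWeightedHomogeneous_of_mul hg0 hg hhom)
    exact Ideal.mul_mem_mul (Ideal.mem_span_singleton_self g)
      (Ideal.subset_span ⟨k, ⟨hk, hmem⟩, rfl⟩)
  · rw [Ideal.span_singleton_mul_le_iff]
    intro x hx
    induction hx using Submodule.span_induction with
    | mem x hx =>
      obtain ⟨k, hk, rfl⟩ := hx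
      exact hk.2
    | zero => rw [mul_zero]; exact zero_mem _
    | add x y _ _ hx hy => rw [mul_add]; exact add_mem hx hy
    | smul c x _ hx =>
      rw [smul_eq_mul, mul_left_comm]
      exact Ideal.mul_mem_left _ c hx

theorem span_image_weightSubst (p q : ℕ) (s : Set Poly) :
    Ideal.span (weightSubst p q '' s) = (Ideal.span s).map
      (MvPolynomial.aeval ![(MvPolynomial.X 0 : Poly) ^ q, (MvPolynomial.X 1 : Poly) ^ p]) :=
  (Ideal.map_span _ s).symm

/-- Noetherianity, with the generators picked inside `s` so that they keep the properties of its
elements. -/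
theorem exists_fin_family_span_eq (s : Set Poly) :
    ∃ (n : ℕ) (k : Fin n → Poly), (∀ i, k i ∈ s) ∧ Ideal.span (Set.range k) = Ideal.span s := by
  obtain ⟨t, hts, ht⟩ := (Submodule.fg_span_iff_fg_span_finset_subset s).1
    (IsNoetherian.noetherian (Ideal.span s))
  refine ⟨t.card, fun i => t.equivFin.symm i, fun i => hts (t.equivFin.symm i).2, ?_⟩
  have : Set.range (fun i => (t.equivFin.symm i : Poly)) = t := by
    rw [Set.range_comp' Subtype.val, t.equivFin.symm.surjective.range_eq]
    simp
  rw [this]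
  exact ht.symm

/-- A criterion for `HasFaceData` with prescribed monomial factor. -/
theorem hasFaceData_of_faceCofactors {I : Ideal Series} {p q : ℕ} (hp : 0 < p)
    (hq : 0 < q) (hpq : Nat.Coprime p q) {F : Poly} {W d a b : ℕ}
    (hF : (∃ n, F.IsHomogeneous n ∧ MvPolynomial.coeff (expo 0 n) F = 1) ∧
      ¬ (MvPolynomial.X 0 ∣ F) ∧ ¬ (MvPolynomial.X 1 ∣ F))
    {g : Poly} (hg : g = MvPolynomial.X 0 ^ a * MvPolynomial.X 1 ^ b * weightSubst p q F)
    (hg0 : g ≠ 0) (hgW : g.IsWeightedHomogeneous ![p, q] W)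
    (hI : initialIdeal I p q (W + p * q * d) ≤ Ideal.span {g})
    (hcop : ∀ h : Poly, (∀ k ∈ faceCofactors I p q (W + p * q * d) g d, h ∣ k) → IsUnit h) :
    HasFaceData I p q (W + p * q * d) F d := by
  obtain ⟨s, k, hk, hspan⟩ :=
    exists_fin_family_span_eq (faceCofactors I p q (W + p * q * d) g d)
  refine ⟨hF.1, hF.2.1, hF.2.2, a, b, s, k, fun i => (hk i).1,
    fun h hh => hcop h fun x hx => ?_, ?_⟩
  · rw [← Ideal.mem_span_singleton]
    refine (?_ : Ideal.span (Set.range k) ≤ Ideal.span {h}) (hspan ▸ Ideal.subset_span hx)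
    rw [Ideal.span_le]
    rintro _ ⟨i, rfl⟩
    exact Ideal.mem_span_singleton.2 (hh i)
  · rw [initialIdeal_eq_span_mul_faceCofactors hp hq hpq hg0 hgW hI, ← hg,
      span_image_weightSubst, ← hspan, ← span_image_weightSubst, ← Set.range_comp]
    rfl

/-- The weights in a description of the initial ideal as in `HasFaceData`. -/
theorem exists_weight_of_initialIdeal_eq {I : Ideal Series} {p q N : ℕ} (hp : 0 < p)
    (hq : 0 < q) {F : Poly} {n d a b s : ℕ} (hF : F.IsHomogeneous n) (hF0 : F ≠ 0)
    {k : Fin s → Poly} (hk : ∀ i, (k i).IsHomogeneous d)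
    (hcop : ∀ g : Poly, (∀ i, g ∣ k i) → IsUnit g) {g : Poly}
    (hg : g = MvPolynomial.X 0 ^ a * MvPolynomial.X 1 ^ b * weightSubst p q F)
    (hI : initialIdeal I p q N =
      Ideal.span {g} * Ideal.span (Set.range fun i => weightSubst p q (k i))) :
    g ≠ 0 ∧ ∃ W, g.IsWeightedHomogeneous ![p, q] W ∧ N = W + p * q * d := by
  have hg0 : g ≠ 0 := by
    rw [hg]
    exact mul_ne_zero (mul_ne_zero (pow_ne_zero _ (MvPolynomial.X_ne_zero 0))
      (pow_ne_zero _ (MvPolynomial.X_ne_zero 1))) (weightSubst_ne_zero hp hq hF0)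
  have hgW : g.IsWeightedHomogeneous ![p, q] (a * p + b * q + p * q * n) := by
    have h0 := (MvPolynomial.isWeightedHomogeneous_X ℂ ![p, q] 0).pow a
    have h1 := (MvPolynomial.isWeightedHomogeneous_X ℂ ![p, q] 1).pow b
    rw [hg]
    exact (h0.mul h1).mul (isWeightedHomogeneous_weightSubst p q hF)
  refine ⟨hg0, _, hgW, ?_⟩
  obtain ⟨i, hi⟩ : ∃ i, k i ≠ 0 := by
    by_contra! h
    exact not_isUnit_zero (hcop 0 fun i => by rw [h i])
  have hgk : ∀ i, (g * weightSubst p q (k i)).IsWeightedHomogeneous ![p, q]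
      (a * p + b * q + p * q * n + p * q * d) :=
    fun i => hgW.mul (isWeightedHomogeneous_weightSubst p q (hk i))
  have hmem : g * weightSubst p q (k i) ∈ initialIdeal I p q N := by
    rw [hI]
    exact Ideal.mul_mem_mul (Ideal.mem_span_singleton_self g) (Ideal.subset_span ⟨i, rfl⟩)
  have hne : g * weightSubst p q (k i) ≠ 0 := mul_ne_zero hg0 (weightSubst_ne_zero hp hq hi)
  -- The two sets of generators have weights `N` and `W + p * q * d`; a nonzero form from either set
  -- lies in the span of the other, which bounds its weight from below.
  apply le_antisymm
  · refine le_of_mem_span_of_isWeightedHomogeneous ?_ hne (hgk i) hmem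
    rintro _ ⟨f, -, rfl⟩
    exact isWeightedHomogeneous_initialPart hp hq N f
  · obtain ⟨f, hf, hf0⟩ : ∃ f ∈ I, initialPart p q N f ≠ 0 := by
      by_contra! h
      have : initialIdeal I p q N ≤ ⊥ := Ideal.span_le.2 (by rintro _ ⟨f, hf, rfl⟩; exact h f hf)
      exact hne (this hmem)
    have hf' : initialPart p q N f ∈ initialIdeal I p q N := Ideal.subset_span ⟨f, hf, rfl⟩
    rw [hI, Ideal.span_mul_span'] at hf'
    refine le_of_mem_span_of_isWeightedHomogeneous ?_ hf0
      (isWeightedHomogeneous_initialPart hp hq N f) hf'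
    rintro _ ⟨_, rfl, _, ⟨i, rfl⟩, rfl⟩
    exact hgk i

/-- The factor `g` and the degree `d` are kept; only coprimality of the cofactors is at stake. From
`J` to `I`, a common divisor `h` for `I` puts its initial ideal, hence that of `J`, inside `(g * h(x
^ q, y ^ p))`, so `h` divides every `k i`. From `I` to `J`, the `k i` are themselves cofactors for
`J`. -/
theorem IsReduction.hasFaceData_iff {I J : Ideal Series} (hIJ : IsReduction I J) {p q N : ℕ}
    (hp : 0 < p) (hq : 0 < q) (hpq : Nat.Coprime p q) (hW : WeightGE I p q N) (F : Poly) (d : ℕ) :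
    HasFaceData J p q N F d ↔ HasFaceData I p q N F d := by
  have hred := hIJ.isReduction_initialIdeal hp hq hW
  have hclosed := integrallyClosedSpan_of_uniqueFactorizationMonoid (R := Poly)
  constructor
  · rintro ⟨⟨n, hF, hF1⟩, hx, hy, a, b, s, k, hk, hcop, hJ⟩
    have hF0 : F ≠ 0 := by rintro rfl; exact hx (dvd_zero _)
    generalize hg : MvPolynomial.X 0 ^ a * MvPolynomial.X 1 ^ b * weightSubst p q F = g at hJ
    obtain ⟨hg0, W, hgW, rfl⟩ :=
      exists_weight_of_initialIdeal_eq hp hq hF hF0 hk hcop hg.symm hJ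
    have hI : initialIdeal I p q (W + p * q * d) ≤ Ideal.span {g} :=
      hred.le.trans (hJ.trans_le Ideal.mul_le_left)
    refine hasFaceData_of_faceCofactors hp hq hpq ⟨⟨n, hF, hF1⟩, hx, hy⟩ hg.symm hg0 hgW hI
      fun h hh => hcop h fun i => dvd_of_weightSubst_dvd hp hq ?_
    have hIh : initialIdeal I p q (W + p * q * d) ≤ Ideal.span {g * weightSubst p q h} := by
      rw [initialIdeal_eq_span_mul_faceCofactors hp hq hpq hg0 hgW hI,
        ← Ideal.span_singleton_mul_span_singleton]
      refine Ideal.mul_mono_right (Ideal.span_le.2 ?_)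
      rintro _ ⟨x, hx, rfl⟩
      exact Ideal.mem_span_singleton.2 (map_dvd _ (hh x hx))
    have hJh := (hred.le_span_singleton_iff (hclosed _)).2 hIh
    have hmem : g * weightSubst p q (k i) ∈ initialIdeal J p q (W + p * q * d) := by
      rw [hJ]
      exact Ideal.mul_mem_mul (Ideal.mem_span_singleton_self g) (Ideal.subset_span ⟨i, rfl⟩)
    exact (mul_dvd_mul_iff_left hg0).1 (Ideal.mem_span_singleton.1 (hJh hmem))
  · rintro ⟨⟨n, hF, hF1⟩, hx, hy, a, b, s, k, hk, hcop, hI⟩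
    have hF0 : F ≠ 0 := by rintro rfl; exact hx (dvd_zero _)
    generalize hg : MvPolynomial.X 0 ^ a * MvPolynomial.X 1 ^ b * weightSubst p q F = g at hI
    obtain ⟨hg0, W, hgW, rfl⟩ :=
      exists_weight_of_initialIdeal_eq hp hq hF hF0 hk hcop hg.symm hI
    refine hasFaceData_of_faceCofactors hp hq hpq ⟨⟨n, hF, hF1⟩, hx, hy⟩ hg.symm hg0 hgW
      ((hred.le_span_singleton_iff (hclosed g)).2 (hI.trans_le Ideal.mul_le_left))
      fun h hh => hcop h fun i => hh _ ⟨hk i, hred.le ?_⟩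
    rw [hI]
    exact Ideal.mul_mem_mul (Ideal.mem_span_singleton_self g) (Ideal.subset_span ⟨i, rfl⟩)

/-! ### The Newton process of a reduction -/

theorem IsReduction.isFace_and_hasFaceData_iff {I J : Ideal Series} (hIJ : IsReduction I J)
    {p q N : ℕ} {F : Poly} {d : ℕ} : IsFace J p q N ∧ HasFaceData J p q N F d ↔
      IsFace I p q N ∧ HasFaceData I p q N F d := by
  rw [hIJ.isFace_iff]
  refine and_congr_right fun h => ?_
  obtain ⟨hp, hq, hpq, hW, -⟩ := isFace_iff_contactSet_nontrivial.1 h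
  exact hIJ.hasFaceData_iff hp hq hpq hW F d

theorem IsReduction.isRootMap_iff {I J : Ideal Series} (hIJ : IsReduction I J) (σ : NewtonMap) :
    IsRootMap J σ ↔ IsRootMap I σ := by
  simp only [IsRootMap, ← and_assoc, hIJ.isFace_and_hasFaceData_iff]

theorem IsReduction.mapIdeal {I J : Ideal Series} (hIJ : IsReduction I J) (σ : NewtonMap) :
    IsReduction (σ.mapIdeal I) (σ.mapIdeal J) :=
  hIJ.map (σ.hom : Series →+* Series)

theorem IsReduction.transform {I J : Ideal Series} (hIJ : IsReduction I J) (L : List NewtonMap) :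
    IsReduction (transform I L) (transform J L) := by
  induction L generalizing I J with
  | nil => exact hIJ
  | cons σ L ih => exact ih (hIJ.mapIdeal σ)

/-- The conditions on one map depend only on reduction-invariant data, and the next pair of ideals
is again a reduction. -/
theorem IsReduction.inAlgorithm_iff {I J : Ideal Series} (hIJ : IsReduction I J)
    (L : List NewtonMap) : InAlgorithm J L ↔ InAlgorithm I L := by
  induction L generalizing I J with
  | nil => exact Iff.rfl
  | cons σ L ih =>
    simp only [InAlgorithm, hIJ.depthZero_iff, hIJ.isRootMap_iff, ih (hIJ.mapIdeal σ)]

theorem IsReduction.inProcess_iff {I J : Ideal Series} (hIJ : IsReduction I J)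
    (e : ProcessElement) : InProcess J e ↔ InProcess I e := by
  cases e with
  | dicritical L p q d =>
    have h := hIJ.transform L
    simp only [InProcess, hIJ.inAlgorithm_iff, h.depthZero_iff, h.isFace_and_hasFaceData_iff]
  | branch L y ν =>
    have h := hIJ.transform L
    simp only [InProcess, hIJ.inAlgorithm_iff, h.depthZero_iff, h.isGeneratedBy_iff, h.yOrder_eq]

theorem IsReduction.newtonProcess_eq {I J : Ideal Series} (hIJ : IsReduction I J) :
    newtonProcess J = newtonProcess I := by
  simp only [newtonProcess, hIJ.xOrder_eq, hIJ.inProcess_iff]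

end NewtonAlg

theorem mainTheorem6 (I : Ideal NewtonAlg.Series) (hI : I ≠ ⊥) :
    NewtonAlg.newtonProcess (NewtonAlg.integralClosure I) = NewtonAlg.newtonProcess I :=
  (NewtonAlg.isReduction_integralClosure I).newtonProcess_eq
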